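/- All graphs and digraphs are finite; graphs are simple, and digraphs have neither loops nor parallel arcs. For positive integers $i,j$, an $\langle i,j\rangle$ digraph is a digraph in which every vertex has indegree at most $i$ and outdegree at most $j$. The competition graph of a digraph $D$ is the graph on the vertex set of $D$ in which two distinct vertices are adjacent if and only if they have a common out-neighbor in $D$. A graph is an $\langle i,j\rangle$ competition graph if it is the competition graph of some $\langle i,j\rangle$ digraph. Let $\omega(G)$ denote the clique number of $G$, that is, the number of vertices in a maximum clique of $G$. Then the following hold for all positive integers $i$ and $j$. (a) If $i>j\ge 2$, then every $\langle i,j\rangle$ competition graph $G$ satisfies $\omega(G)<ij-j+1$. (b) There is a $\langle 2,j\rangle$ competition graph $G$ with $\omega(G)=j+1$. (c) There is a $\langle 3,j\rangle$ competition graph $G$ with $\omega(G)=2j+1$ if and only if $j=1$, or $j=3n$ or $j=3n+1$ for some integer $n\ge 1$. -/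

import Mathlib

/-- An `⟨i, j⟩` digraph: a loopless digraph (without parallel arcs) in which every vertex has
indegree at most `i` and outdegree at most `j`. -/
structure IsBoundedDigraph {V : Type*} (i j : ℕ) (D : Digraph V) : Prop where
  loopless : ∀ v, ¬ D.Adj v v
  indegree_le : ∀ v, {u | D.Adj u v}.encard ≤ i
  outdegree_le : ∀ v, {w | D.Adj v w}.encard ≤ j

/-- The competition graph of a digraph `D`: the simple graph on the vertices of `D` in which two
distinct vertices are adjacent if and only if they have a common out-neighbor in `D`. -/
def competitionGraph {V : Type*} (D : Digraph V) : SimpleGraph V where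
  Adj u v := u ≠ v ∧ ∃ w, D.Adj u w ∧ D.Adj v w
  symm := ⟨fun _ _ h => ⟨h.1.symm, h.2.imp fun _ hw => ⟨hw.2, hw.1⟩⟩⟩
  loopless := ⟨fun _ h => h.1 rfl⟩

/-- A graph is an `⟨i, j⟩` competition graph if it is the competition graph of some `⟨i, j⟩`
digraph. -/
def IsBoundedCompetitionGraph {V : Type*} (i j : ℕ) (G : SimpleGraph V) : Prop :=
  ∃ D : Digraph V, IsBoundedDigraph i j D ∧ competitionGraph D = G

open Finset

/-! ### Size of cliques and the structure of extremal ones. -/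

section UpperBound

variable {V : Type*}

/-! Put `i = k + 1`. A clique vertex has at most `j` out-neighbors, each shared with at most `k`
other vertices, so a clique has at most `j * k + 1` vertices. For `k ≥ 1`, equality leaves no slack:
the nonempty sets `inNbrs D w ∩ s` are blocks of size `k + 1`, two points lie in exactly one common
block, and each point lies in `j` blocks (`card_inNbrs_inter`, `common_outNbr_unique`,
`card_outNbrs`). So `s` carries a Steiner system. A point off a block then needs `k + 1` different
blocks to reach it, which gives (a); counting incidences gives the divisibility behind (c).
Conversely, an economical covering of all pairs by blocks yields an extremal digraph with arcs from
points to blocks (`exists_competitionGraph_of_cover`): all pairs for (b), the triple systems of Bose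
and Skolem for (c). -/

lemma exists_common_outNbr {D : Digraph V} {s : Finset V} {u v : V}
    (hs : (competitionGraph D).IsClique s) (hu : u ∈ s) (hv : v ∈ s)
    (huv : u ≠ v) : ∃ w, D.Adj u w ∧ D.Adj v w :=
  (hs hu hv huv).2

variable [Fintype V]

open Classical in
/-- The in-neighbors of a vertex of a finite digraph. -/
noncomputable def inNbrs (D : Digraph V) (w : V) : Finset V := {u | D.Adj u w}

open Classical in
/-- The out-neighbors of a vertex of a finite digraph. -/
noncomputable def outNbrs (D : Digraph V) (v : V) : Finset V := {w | D.Adj v w}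

variable {D : Digraph V} {k j : ℕ} {s : Finset V} {u v w w' : V}

lemma mem_inNbrs : u ∈ inNbrs D w ↔ D.Adj u w := by simp [inNbrs]

lemma mem_outNbrs : w ∈ outNbrs D v ↔ D.Adj v w := by simp [outNbrs]

lemma IsBoundedDigraph.card_inNbrs_le (hD : IsBoundedDigraph k j D) (w : V) :
    #(inNbrs D w) ≤ k := by
  have h := hD.indegree_le w
  have e : {u | D.Adj u w} = (inNbrs D w : Set V) := by ext; simp [mem_inNbrs]
  rw [e, Set.encard_coe_eq_coe_finsetCard] at h
  exact_mod_cast h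

lemma IsBoundedDigraph.card_outNbrs_le (hD : IsBoundedDigraph k j D) (v : V) :
    #(outNbrs D v) ≤ j := by
  have h := hD.outdegree_le v
  have e : {w | D.Adj v w} = (outNbrs D v : Set V) := by ext; simp [mem_outNbrs]
  rw [e, Set.encard_coe_eq_coe_finsetCard] at h
  exact_mod_cast h

variable [DecidableEq V]

lemma card_biUnion_inNbrs_erase_le (hD : IsBoundedDigraph (k + 1) j D) {t : Finset V}
    (ht : t ⊆ outNbrs D v) : #(t.biUnion fun w ↦ (inNbrs D w).erase v) ≤ #t * k := by
  refine card_biUnion_le_card_mul _ _ _ fun w hw ↦ ?_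
  rw [card_erase_of_mem (mem_inNbrs.2 (mem_outNbrs.1 (ht hw)))]
  have := hD.card_inNbrs_le w
  omega

lemma card_le_card_outNbrs_mul (hD : IsBoundedDigraph (k + 1) j D)
    (hs : (competitionGraph D).IsClique s) (hv : v ∈ s) : #s ≤ #(outNbrs D v) * k + 1 := by
  have hsub : s.erase v ⊆ (outNbrs D v).biUnion fun w ↦ (inNbrs D w).erase v := by
    intro u hu
    obtain ⟨hne, hu⟩ := mem_erase.1 hu
    obtain ⟨w, h1, h2⟩ := exists_common_outNbr hs hu hv hne
    exact mem_biUnion.2 ⟨w, mem_outNbrs.2 h2, mem_erase.2 ⟨hne, mem_inNbrs.2 h1⟩⟩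
  have h := (card_le_card hsub).trans (card_biUnion_inNbrs_erase_le hD subset_rfl)
  rw [card_erase_of_mem hv] at h
  omega

/-- A clique in the competition graph of a `⟨k + 1, j⟩` digraph has at most `j * k + 1`
vertices. -/
lemma card_clique_le (hD : IsBoundedDigraph (k + 1) j D)
    (hs : (competitionGraph D).IsClique s) : #s ≤ j * k + 1 := by
  obtain rfl | ⟨v, hv⟩ := s.eq_empty_or_nonempty
  · simp
  · have := Nat.mul_le_mul_right k (hD.card_outNbrs_le v)
    have := card_le_card_outNbrs_mul hD hs hv
    omega

/-- In a clique of the extremal size, the vertices reached from `v` through a given out-neighbor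
cannot be replaced by fewer than `k` vertices. -/
lemma le_card_of_cover (hD : IsBoundedDigraph (k + 1) j D) (hcard : #s = j * k + 1)
    (hv : v ∈ s) (hw : D.Adj v w) {t : Finset V}
    (ht : ∀ u ∈ s, u ≠ v → u ∉ t → ∃ w' ≠ w, D.Adj u w' ∧ D.Adj v w') : k ≤ #t := by
  have hsub : s.erase v ⊆
      (((outNbrs D v).erase w).biUnion fun w ↦ (inNbrs D w).erase v) ∪ t := by
    intro u hu
    obtain ⟨hne, hu⟩ := mem_erase.1 hu
    by_cases hut : u ∈ t
    · exact mem_union_right _ hut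
    · obtain ⟨w', h, h1, h2⟩ := ht u hu hne hut
      exact mem_union_left _ (mem_biUnion.2 ⟨w', mem_erase.2 ⟨h, mem_outNbrs.2 h2⟩,
        mem_erase.2 ⟨hne, mem_inNbrs.2 h1⟩⟩)
  have h1 := (card_le_card hsub).trans (card_union_le _ _)
  have h2 := card_biUnion_inNbrs_erase_le hD (erase_subset w (outNbrs D v))
  have hmem := mem_outNbrs.2 hw
  rw [card_erase_of_mem hmem] at h2
  rw [card_erase_of_mem hv] at h1
  have hpos := card_pos.2 ⟨w, hmem⟩
  have hj := hD.card_outNbrs_le v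
  have h3 : (#(outNbrs D v) - 1) * k ≤ (j - 1) * k := Nat.mul_le_mul_right _ (by omega)
  have h4 : (j - 1) * k + k = j * k := by
    rw [← Nat.succ_mul]; congr 1; omega
  omega

lemma card_inNbrs_inter (hD : IsBoundedDigraph (k + 1) j D)
    (hs : (competitionGraph D).IsClique s) (hcard : #s = j * k + 1)
    (hv : v ∈ s) (hw : D.Adj v w) : #(inNbrs D w ∩ s) = k + 1 := by
  have hmem : v ∈ inNbrs D w ∩ s := mem_inter.2 ⟨mem_inNbrs.2 hw, hv⟩
  have h : k ≤ #((inNbrs D w ∩ s).erase v) := by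
    refine le_card_of_cover hD hcard hv hw fun u hu hne hut ↦ ?_
    obtain ⟨w', h1, h2⟩ := exists_common_outNbr hs hu hv hne
    refine ⟨w', ?_, h1, h2⟩
    rintro rfl
    exact hut (mem_erase.2 ⟨hne, mem_inter.2 ⟨mem_inNbrs.2 h1, hu⟩⟩)
  rw [card_erase_of_mem hmem] at h
  have h1 := card_pos.2 ⟨v, hmem⟩
  have h2 := (card_le_card (inter_subset_left (s₁ := inNbrs D w) (s₂ := s))).trans
    (hD.card_inNbrs_le w)
  omega

lemma card_outNbrs (hD : IsBoundedDigraph (k + 1) j D) (hk : 0 < k)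
    (hs : (competitionGraph D).IsClique s) (hcard : #s = j * k + 1) (hv : v ∈ s) :
    #(outNbrs D v) = j := by
  refine le_antisymm (hD.card_outNbrs_le v) ?_
  have := card_le_card_outNbrs_mul hD hs hv
  exact Nat.le_of_mul_le_mul_right (by omega) hk

/-- In a clique of the extremal size, two vertices have only one common out-neighbor. -/
lemma common_outNbr_unique (hD : IsBoundedDigraph (k + 1) j D)
    (hs : (competitionGraph D).IsClique s) (hcard : #s = j * k + 1)
    (hu : u ∈ s) (hv : v ∈ s) (huv : u ≠ v) (huw : D.Adj u w) (hvw : D.Adj v w)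
    (huw' : D.Adj u w') (hvw' : D.Adj v w') : w = w' := by
  by_contra hww
  have hmu : u ∈ (inNbrs D w).erase v := mem_erase.2 ⟨huv, mem_inNbrs.2 huw⟩
  -- Since `v` also reaches `u` through `w'`, the out-neighbor `w` would be needed for at most `k -
  -- 1` vertices.
  have h : k ≤ #(((inNbrs D w).erase v).erase u) := by
    refine le_card_of_cover hD hcard hv hvw fun x hx hne hxt ↦ ?_
    by_cases hxu : x = u
    · subst hxu
      exact ⟨w', Ne.symm hww, huw', hvw'⟩
    obtain ⟨y, h1, h2⟩ := exists_common_outNbr hs hx hv hne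
    refine ⟨y, ?_, h1, h2⟩
    rintro rfl
    exact hxt (mem_erase.2 ⟨hxu, mem_erase.2 ⟨hne, mem_inNbrs.2 h1⟩⟩)
  have hpos := card_pos.2 ⟨u, hmu⟩
  rw [card_erase_of_mem hmu] at h
  rw [card_erase_of_mem (mem_inNbrs.2 hvw)] at h hpos
  have := hD.card_inNbrs_le w
  omega

/-- A point `p` off a block is joined to its `k + 1 > j` points through only `j` out-neighbors. By
pigeonhole two of these points share one, and uniqueness puts `p` on the block. -/
lemma card_clique_ne (hD : IsBoundedDigraph (k + 1) j D) (hj : 2 ≤ j) (hjk : j < k + 1)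
    (hs : (competitionGraph D).IsClique s) : #s ≠ j * k + 1 := by
  intro hcard
  obtain ⟨v, hv⟩ : s.Nonempty := card_pos.1 (by omega)
  obtain ⟨w, hw⟩ : (outNbrs D v).Nonempty := card_pos.1 (by
    rw [card_outNbrs hD (by omega) hs hcard hv]; omega)
  rw [mem_outNbrs] at hw
  have hB := card_inNbrs_inter hD hs hcard hv hw
  obtain ⟨p, hp, hpw⟩ : ∃ p ∈ s, p ∉ inNbrs D w := by
    by_contra! hall
    have h1 := (card_le_card hall).trans (hD.card_inNbrs_le w)
    have h2 : 2 * k ≤ j * k := Nat.mul_le_mul_right k hj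
    omega
  rw [mem_inNbrs] at hpw
  have hex : ∀ u ∈ inNbrs D w ∩ s, ∃ y, D.Adj u y ∧ D.Adj p y := by
    intro u hu
    obtain ⟨h1, h2⟩ := mem_inter.1 hu
    refine exists_common_outNbr hs h2 hp ?_
    rintro rfl
    exact hpw (mem_inNbrs.1 h1)
  choose! f hf using hex
  obtain ⟨a, ha, b, hb, hab, he⟩ := exists_ne_map_eq_of_card_lt_of_maps_to
    (s := inNbrs D w ∩ s) (t := outNbrs D p) (f := f)
    (by have := hD.card_outNbrs_le p; omega) (fun u hu ↦ mem_outNbrs.2 (hf u hu).2)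
  obtain ⟨ha1, ha2⟩ := mem_inter.1 ha
  obtain ⟨hb1, hb2⟩ := mem_inter.1 hb
  have := common_outNbr_unique hD hs hcard ha2 hb2 hab (mem_inNbrs.1 ha1) (mem_inNbrs.1 hb1)
    (hf a ha).1 (he ▸ (hf b hb).1)
  exact hpw (this ▸ (hf a ha).2)

/-- Double count the arcs leaving the clique: each `w` receives either none or `k + 1` of them. -/
lemma dvd_of_card_clique (hD : IsBoundedDigraph (k + 1) j D) (hk : 0 < k)
    (hs : (competitionGraph D).IsClique s) (hcard : #s = j * k + 1) :
    k + 1 ∣ (j * k + 1) * j := by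
  classical
  have h1 := sum_card_bipartiteAbove_eq_sum_card_bipartiteBelow (s := s) (t := univ) D.Adj
  have h2 : ∀ v ∈ s, #(bipartiteAbove D.Adj univ v) = j := by
    intro v hv
    rw [← card_outNbrs hD hk hs hcard hv]
    congr 1
  rw [sum_congr rfl h2, sum_const, hcard, smul_eq_mul] at h1
  rw [h1]
  refine dvd_sum fun w _ ↦ ?_
  have e : bipartiteBelow D.Adj s w = inNbrs D w ∩ s := by
    ext v
    simp [mem_inNbrs, bipartiteBelow, and_comm]
  rw [e]
  obtain h | ⟨v, hv⟩ := (inNbrs D w ∩ s).eq_empty_or_nonempty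
  · simp [h]
  · obtain ⟨hv1, hv2⟩ := mem_inter.1 hv
    rw [card_inNbrs_inter hD hs hcard hv2 (mem_inNbrs.1 hv1)]

end UpperBound

/-! ### Extremal digraphs from block designs. -/

section Existence

/-- A family of at most `card P * j / (k + 1)` blocks of size at most `k + 1` that covers all pairs
of the `j * k + 1` points of `P` yields a competition graph with a clique of the extremal size. -/
lemma exists_competitionGraph_of_cover {P : Type} [Fintype P] [DecidableEq P] {k j : ℕ}
    (hk : 0 < k) (B : Finset (Finset P)) (hP : Fintype.card P = j * k + 1)
    (hsize : ∀ b ∈ B, #b ≤ k + 1) (hcov : ∀ x y, x ≠ y → ∃ b ∈ B, x ∈ b ∧ y ∈ b)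
    (hB : (k + 1) * #B ≤ (j * k + 1) * j) :
    ∃ (V : Type) (_ : Finite V) (G : SimpleGraph V),
      IsBoundedCompetitionGraph (k + 1) j G ∧ G.cliqueNum = j * k + 1 := by
  -- The outdegree bound is not assumed. Covering forces at least `j` blocks through each point, and
  -- the bound on `#B` forces equality everywhere.
  have hge : ∀ p ∈ (univ : Finset P), j ≤ #{b ∈ B | p ∈ b} := by
    intro p _
    have hsub : univ.erase p ⊆ {b ∈ B | p ∈ b}.biUnion fun b ↦ b.erase p := by
      intro x hx
      obtain ⟨b, hb, h1, h2⟩ := hcov x p (ne_of_mem_erase hx)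
      exact mem_biUnion.2 ⟨b, mem_filter.2 ⟨hb, h2⟩, mem_erase.2 ⟨ne_of_mem_erase hx, h1⟩⟩
    have h := (card_le_card hsub).trans (card_biUnion_le_card_mul _ _ k fun b hb ↦ by
      obtain ⟨h1, h2⟩ := mem_filter.1 hb
      rw [card_erase_of_mem h2]
      have := hsize b h1
      omega)
    rw [card_erase_of_mem (mem_univ p), card_univ, hP] at h
    exact Nat.le_of_mul_le_mul_right (by omega) hk
  have hdeg : ∀ p ∈ (univ : Finset P), j = #{b ∈ B | p ∈ b} := by
    rw [← sum_eq_sum_iff_of_le hge]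
    refine le_antisymm (sum_le_sum hge) ?_
    have h1 := sum_card_bipartiteAbove_eq_sum_card_bipartiteBelow (s := (univ : Finset P))
      (t := B) (fun p b ↦ p ∈ b)
    have h2 : ∑ b ∈ B, #(bipartiteBelow (fun p b ↦ p ∈ b) univ b) ≤ #B * (k + 1) := by
      refine sum_le_card_nsmul _ _ _ fun b hb ↦ ?_
      simpa [bipartiteBelow] using hsize b hb
    rw [sum_const, card_univ, hP, smul_eq_mul]
    unfold bipartiteAbove at h1
    rw [h1]
    linarith
  let D : Digraph (P ⊕ Finset P) :=
    ⟨fun u w ↦ ∃ p b, u = Sum.inl p ∧ w = Sum.inr b ∧ b ∈ B ∧ p ∈ b⟩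
  have hD : IsBoundedDigraph (k + 1) j D := by
    refine ⟨?_, ?_, ?_⟩
    · rintro v ⟨p, b, rfl, h, -⟩
      cases h
    · rintro (q | b)
      · have : {u | D.Adj u (Sum.inl q)} = ∅ := by
          ext u; simp [D]
        simp [this]
      · by_cases hb : b ∈ B
        · have : {u | D.Adj u (Sum.inr b)} = 
              ((b.map Function.Embedding.inl : Finset (P ⊕ Finset P)) : Set _) := by
            ext u; simp [D, hb, and_comm, eq_comm]
          rw [this, Set.encard_coe_eq_coe_finsetCard, card_map]
          exact_mod_cast hsize b hb
        · have : {u | D.Adj u (Sum.inr b)} = ∅ := by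
            ext u; simp [D, hb]
          simp [this]
    · rintro (p | b)
      · have : {w | D.Adj (Sum.inl p) w} =
            (({b ∈ B | p ∈ b}.map Function.Embedding.inr : Finset (P ⊕ Finset P)) : Set _) := by
          ext u; simp [D, and_comm, and_assoc, eq_comm]
        rw [this, Set.encard_coe_eq_coe_finsetCard, card_map, ← hdeg p (mem_univ p)]
      · have : {w | D.Adj (Sum.inr b) w} = ∅ := by
          ext u; simp [D]
        simp [this]
  refine ⟨P ⊕ Finset P, inferInstance, competitionGraph D, ⟨D, hD, rfl⟩, le_antisymm ?_ ?_⟩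
  · obtain ⟨s, hs⟩ := (competitionGraph D).exists_isNClique_cliqueNum
    rw [← hs.card_eq]
    exact card_clique_le hD hs.isClique
  · have hc : (competitionGraph D).IsClique
        ((univ.map Function.Embedding.inl : Finset (P ⊕ Finset P)) : Set _) := by
      intro u hu v hv huv
      obtain ⟨p, -, rfl⟩ := mem_map.1 (mem_coe.1 hu)
      obtain ⟨q, -, rfl⟩ := mem_map.1 (mem_coe.1 hv)
      obtain ⟨b, hb, hp, hq⟩ := hcov p q (fun h ↦ huv (by rw [h]))
      exact ⟨huv, Sum.inr b, ⟨p, b, rfl, rfl, hb, hp⟩, ⟨q, b, rfl, rfl, hb, hq⟩⟩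
    have := hc.card_le_cliqueNum
    rwa [card_map, card_univ, hP] at this

lemma exists_competitionGraph_two (j : ℕ) :
    ∃ (V : Type) (_ : Finite V) (G : SimpleGraph V),
      IsBoundedCompetitionGraph 2 j G ∧ G.cliqueNum = j * 1 + 1 := by
  refine exists_competitionGraph_of_cover (P := Fin (j + 1)) one_pos (powersetCard 2 univ)
    (by simp) (fun b hb ↦ (mem_powersetCard.1 hb).2.le) (fun x y hxy ↦ ⟨{x, y}, ?_, ?_⟩) ?_
  · simp [card_pair hxy]
  · simp
  · rw [card_powersetCard, card_univ, Fintype.card_fin, mul_one, mul_comm (1 + 1)]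
    exact (Nat.choose_two_right (j + 1)).symm ▸ Nat.div_mul_le_self _ _

/-! ### Triple systems of Bose and Skolem. -/

section MixedBlocks

variable {P Q : Type} [DecidableEq P] [AddCommMonoid Q] [Fintype Q]

/-- The blocks `{(x, i), (y, i), (f (x + y), i + 1)}` with `x ≠ y` of the constructions of Bose
and Skolem, transported to the points `P` by `g`. -/
def mixedBlocks (g : Q × ZMod 3 → P) (f : Q → Q) : Finset (Finset P) :=
  ((powersetCard 2 (univ : Finset Q)) ×ˢ (univ : Finset (ZMod 3))).image fun e ↦
    insert (g (f (∑ x ∈ e.1, x), e.2 + 1)) (e.1.image fun x ↦ g (x, e.2))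

variable (g : Q × ZMod 3 → P) (f : Q → Q)

lemma card_mixedBlocks_le : #(mixedBlocks g f) ≤ (Fintype.card Q).choose 2 * 3 := by
  refine card_image_le.trans ?_
  simp [ZMod.card]

variable {g f}

lemma card_le_of_mem_mixedBlocks {b : Finset P} (hb : b ∈ mixedBlocks g f) : #b ≤ 3 := by
  obtain ⟨⟨e, i⟩, he, rfl⟩ := mem_image.1 hb
  have h := (mem_powersetCard.1 (mem_product.1 he).1).2
  refine (card_insert_le _ _).trans ?_
  exact Nat.succ_le_succ (card_image_le.trans h.le)

variable [DecidableEq Q]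

lemma exists_mem_mixedBlocks {x y : Q} (hxy : x ≠ y) (i : ZMod 3) :
    ∃ b ∈ mixedBlocks g f, g (x, i) ∈ b ∧ g (y, i) ∈ b ∧ g (f (x + y), i + 1) ∈ b := by
  refine ⟨_, mem_image.2 ⟨({x, y}, i), ?_, rfl⟩, ?_, ?_, ?_⟩
  · simp [card_pair hxy]
  · simp
  · simp
  · simp [sum_pair hxy]

end MixedBlocks

lemma zmod_three_cases (i k : ZMod 3) : k = i ∨ k = i + 1 ∨ i = k + 1 := by
  revert i k; decide

lemma two_mul_choose_two (n : ℕ) : 2 * n.choose 2 = n * (n - 1) := by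
  rw [Nat.choose_two_right, Nat.mul_div_cancel' (Nat.even_mul_pred_self n).two_dvd]

/-- The construction of Bose of a Steiner triple system on `6 * n + 3` points. -/
lemma exists_competitionGraph_bose (n : ℕ) :
    ∃ (V : Type) (_ : Finite V) (G : SimpleGraph V),
      IsBoundedCompetitionGraph 3 (3 * n + 1) G ∧ G.cliqueNum = (3 * n + 1) * 2 + 1 := by
  let Q := ZMod (2 * n + 1)
  -- Halving: `n + 1` is the inverse of `2` modulo `2 * n + 1`.
  let f : Q → Q := fun s ↦ (n + 1) * s
  have hf : ∀ y : Q, f (y + y) = y := by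
    intro y
    have h : ((2 * n + 1 : ℕ) : Q) = 0 := ZMod.natCast_self _
    rw [Nat.cast_add, Nat.cast_mul, Nat.cast_one, Nat.cast_two] at h
    linear_combination y * h
  let col : Finset (Finset (Q × ZMod 3)) := univ.image fun x : Q ↦ {x} ×ˢ univ
  have hQ : Fintype.card Q = 2 * n + 1 := ZMod.card _
  have key : ∀ (x y : Q) (i : ZMod 3),
      ∃ b ∈ col ∪ mixedBlocks id f, (x, i) ∈ b ∧ (y, i + 1) ∈ b := by
    intro x y i
    by_cases hxy : x = y
    · subst hxy
      exact ⟨{x} ×ˢ univ, mem_union_left _ (mem_image_of_mem _ (mem_univ x)), by simp, by simp⟩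
    -- The partner `y + y - x` makes the sum `y + y`, whose half is `y`.
    · have hne : x ≠ y + y - x := by
        intro h
        apply hxy
        rw [← hf x, ← hf y]
        congr 1
        nth_rewrite 1 [h]
        ring
      obtain ⟨b, hb, h1, -, h2⟩ := exists_mem_mixedBlocks (g := id) (f := f) hne i
      refine ⟨b, mem_union_right _ hb, h1, ?_⟩
      rwa [show x + (y + y - x) = y + y by ring, hf] at h2
  refine exists_competitionGraph_of_cover (k := 2) two_pos (col ∪ mixedBlocks id f)
    ?_ ?_ ?_ ?_
  · rw [Fintype.card_prod, hQ, ZMod.card]; ring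
  · intro b hb
    obtain hb | hb := mem_union.1 hb
    · obtain ⟨x, -, rfl⟩ := mem_image.1 hb
      simp [ZMod.card]
    · exact card_le_of_mem_mixedBlocks hb
  · rintro ⟨x, i⟩ ⟨y, k⟩ hne
    obtain rfl | rfl | rfl := zmod_three_cases i k
    · obtain ⟨b, hb, h1, h2, -⟩ := exists_mem_mixedBlocks (g := id) (f := f)
        (show x ≠ y by rintro rfl; exact hne rfl) k
      exact ⟨b, mem_union_right _ hb, h1, h2⟩
    · exact key x y i
    · obtain ⟨b, hb, h1, h2⟩ := key y x k
      exact ⟨b, hb, h2, h1⟩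
  · have h1 : #col ≤ 2 * n + 1 := card_image_le.trans (by rw [card_univ, hQ])
    have h2 := card_mixedBlocks_le (P := Q × ZMod 3) id f
    have h3 := card_union_le col (mixedBlocks id f)
    have h4 := two_mul_choose_two (2 * n + 1)
    rw [hQ] at h2
    simp only [Nat.add_sub_cancel] at h4
    nlinarith

/-- Halving on the residues modulo `2 * n`, with the odd ones sent to the upper half. -/
def halfResidue (n : ℕ) (s : ZMod (2 * n)) : ZMod (2 * n) :=
  ((s.val / 2 + s.val % 2 * n : ℕ) : ZMod (2 * n))

/-- As `2 * n` is even, the parity of `m` survives reduction. -/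
lemma halfResidue_natCast {n m a : ℕ} (h : m % (2 * n) / 2 + m % 2 * n = a) :
    halfResidue n (m : ZMod (2 * n)) = a := by
  rw [halfResidue, ZMod.val_natCast, Nat.mod_mod_of_dvd _ (dvd_mul_right 2 n), h]

/-- The construction of Skolem of a Steiner triple system on `6 * n + 1` points. -/
lemma exists_competitionGraph_skolem {n : ℕ} (hn : 0 < n) :
    ∃ (V : Type) (_ : Finite V) (G : SimpleGraph V),
      IsBoundedCompetitionGraph 3 (3 * n) G ∧ G.cliqueNum = (3 * n) * 2 + 1 := by
  have : NeZero (2 * n) := ⟨by omega⟩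
  let Q := ZMod (2 * n)
  let f : Q → Q := halfResidue n
  have hQ : Fintype.card Q = 2 * n := ZMod.card _
  have hrep : ∀ x : Q, ∃ a < n, x = (a : Q) ∨ x = ((a + n : ℕ) : Q) := by
    intro x
    have hx := ZMod.val_lt x
    have hv : ((x.val : ℕ) : Q) = x := ZMod.natCast_zmod_val x
    by_cases h : x.val < n
    · exact ⟨x.val, h, Or.inl hv.symm⟩
    · refine ⟨x.val - n, by omega, Or.inr ?_⟩
      rw [show x.val - n + n = x.val by omega, hv]
  have hlow : ∀ a < n, f ((a : Q) + a) = a := by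
    intro a ha
    rw [← Nat.cast_add]
    refine halfResidue_natCast ?_
    rw [Nat.mod_eq_of_lt (by omega), show (a + a) % 2 = 0 by omega]
    omega
  have hhigh : ∀ a < n, f (((a + n : ℕ) : Q) + (a + n : ℕ)) = a := by
    intro a ha
    rw [← Nat.cast_add]
    refine halfResidue_natCast ?_
    rw [show a + n + (a + n) = a + a + 2 * n by ring, Nat.add_mod_right,
      Nat.mod_eq_of_lt (by omega), show (a + a + 2 * n) % 2 = 0 by omega]
    omega
  have hsurj : ∀ y : Q, ∃ s, f s = y := by
    intro y
    obtain ⟨a, ha, rfl | rfl⟩ := hrep y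
    · exact ⟨_, hlow a ha⟩
    · refine ⟨((2 * a + 1 : ℕ) : Q), halfResidue_natCast ?_⟩
      rw [Nat.mod_eq_of_lt (by omega), show (2 * a + 1) % 2 = 1 by omega]
      omega
  let P := Option (Q × ZMod 3)
  let col : Finset (Finset P) :=
    (range n).image fun a : ℕ ↦ univ.image fun i : ZMod 3 ↦ some ((a : Q), i)
  -- These replace the missing columns: for `x = a + n`, `f (x + x)` is `a` rather than `x`, so the
  -- pair of `x` and `a` on the next level is covered with the extra point `none`.
  let inf : Finset (Finset P) := (range n ×ˢ (univ : Finset (ZMod 3))).image fun e ↦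
    {none, some (((e.1 + n : ℕ) : Q), e.2), some ((e.1 : Q), e.2 + 1)}
  let B := col ∪ inf ∪ mixedBlocks some f
  have hinf : ∀ a < n, ∀ i : ZMod 3,
      {none, some (((a + n : ℕ) : Q), i), some ((a : Q), i + 1)} ∈ B := fun a ha i ↦
    mem_union_left _ (mem_union_right _
      (mem_image.2 ⟨(a, i), mem_product.2 ⟨mem_range.2 ha, mem_univ i⟩, rfl⟩))
  have key : ∀ (x y : Q) (i : ZMod 3), ∃ b ∈ B, some (x, i) ∈ b ∧ some (y, i + 1) ∈ b := by
    intro x y i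
    obtain ⟨s, rfl⟩ := hsurj y
    -- If `s = x + x`, no second point completes `x` to the sum `s`, so a column or a block through
    -- `none` takes over.
    by_cases hs : x = s - x
    · obtain rfl : s = x + x := by rw [eq_sub_iff_add_eq] at hs; exact hs.symm
      obtain ⟨a, ha, rfl | rfl⟩ := hrep x
      · rw [hlow a ha]
        exact ⟨_, mem_union_left _ (mem_union_left _
          (mem_image_of_mem _ (mem_range.2 ha))), by simp, by simp⟩
      · rw [hhigh a ha]
        exact ⟨_, hinf a ha i, by simp, by simp⟩
    · obtain ⟨b, hb, h1, -, h2⟩ := exists_mem_mixedBlocks (g := some) (f := f) hs i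
      refine ⟨b, mem_union_right _ hb, h1, ?_⟩
      rwa [add_sub_cancel] at h2
  have key' : ∀ (x : Q) (i : ZMod 3), ∃ b ∈ B, none ∈ b ∧ some (x, i) ∈ b := by
    intro x i
    obtain ⟨a, ha, rfl | rfl⟩ := hrep x
    · exact ⟨_, hinf a ha (i - 1), by simp, by simp⟩
    · exact ⟨_, hinf a ha i, by simp, by simp⟩
  refine exists_competitionGraph_of_cover (k := 2) two_pos B ?_ ?_ ?_ ?_
  · rw [Fintype.card_option, Fintype.card_prod, hQ, ZMod.card]; ring
  · intro b hb
    obtain hb | hb := mem_union.1 hb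
    · obtain hb | hb := mem_union.1 hb
      · obtain ⟨x, -, rfl⟩ := mem_image.1 hb
        exact card_image_le
      · obtain ⟨x, -, rfl⟩ := mem_image.1 hb
        exact card_le_three
    · exact card_le_of_mem_mixedBlocks hb
  · rintro (_ | ⟨x, i⟩) (_ | ⟨y, k⟩) hne
    · exact absurd rfl hne
    · exact key' y k
    · obtain ⟨b, hb, h1, h2⟩ := key' x i
      exact ⟨b, hb, h2, h1⟩
    obtain rfl | rfl | rfl := zmod_three_cases i k
    · obtain ⟨b, hb, h1, h2, -⟩ := exists_mem_mixedBlocks (g := some) (f := f)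
        (show x ≠ y by rintro rfl; exact hne rfl) k
      exact ⟨b, mem_union_right _ hb, h1, h2⟩
    · exact key x y i
    · obtain ⟨b, hb, h1, h2⟩ := key y x k
      exact ⟨b, hb, h2, h1⟩
  · have h1 : #col ≤ n := card_image_le.trans (by simp)
    have h2 : #inf ≤ n * 3 := card_image_le.trans (by simp [ZMod.card])
    have h3 := card_mixedBlocks_le (P := P) some f
    have h4 := card_union_le (col ∪ inf) (mixedBlocks some f)
    have h5 := card_union_le col inf
    have h6 := two_mul_choose_two (2 * n)
    rw [hQ] at h3
    obtain ⟨m, rfl⟩ : ∃ m, n = m + 1 := ⟨n - 1, by omega⟩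
    rw [show 2 * (m + 1) - 1 = 2 * m + 1 by omega] at h6
    have h7 : #B ≤ 4 * (m + 1) + 3 * (2 * (m + 1)).choose 2 := by
      change #(col ∪ inf ∪ mixedBlocks some f) ≤ _
      omega
    nlinarith

end Existence

theorem corollary2p9 :
    (∀ i j : ℕ, 2 ≤ j → j < i → ∀ (V : Type*) [Finite V] (G : SimpleGraph V),
      IsBoundedCompetitionGraph i j G → G.cliqueNum < i * j - j + 1) ∧
    (∀ j : ℕ, 1 ≤ j → ∃ (V : Type) (_ : Finite V) (G : SimpleGraph V),
      IsBoundedCompetitionGraph 2 j G ∧ G.cliqueNum = j + 1) ∧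
    (∀ j : ℕ, 1 ≤ j →
      ((∃ (V : Type) (_ : Finite V) (G : SimpleGraph V),
          IsBoundedCompetitionGraph 3 j G ∧ G.cliqueNum = 2 * j + 1) ↔
        j = 1 ∨ ∃ n : ℕ, 1 ≤ n ∧ (j = 3 * n ∨ j = 3 * n + 1))) := by
  classical
  refine ⟨?_, fun j _ ↦ ?_, fun j hj ↦ ⟨?_, ?_⟩⟩
  · rintro i j hj hij V _ G ⟨D, hD, rfl⟩
    have := Fintype.ofFinite V
    obtain ⟨k, rfl⟩ : ∃ k, i = k + 1 := ⟨i - 1, by omega⟩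
    obtain ⟨s, hs⟩ := (competitionGraph D).exists_isNClique_cliqueNum
    have h1 := card_clique_le hD hs.isClique
    have h2 := card_clique_ne hD hj hij hs.isClique
    rw [hs.card_eq] at h1 h2
    rw [Nat.succ_mul, Nat.add_sub_cancel, mul_comm k]
    omega
  · simpa using exists_competitionGraph_two j
  · rintro ⟨V, _, G, ⟨D, hD, rfl⟩, hG⟩
    have := Fintype.ofFinite V
    obtain ⟨s, hs⟩ := (competitionGraph D).exists_isNClique_cliqueNum
    have hdvd := dvd_of_card_clique (k := 2) hD two_pos hs.isClique (by
      rw [hs.card_eq, hG, mul_comm])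
    -- For `j ≡ 2` modulo `3`, the product `(2 * j + 1) * j` is `1` modulo `3`.
    have hmod : j % 3 ≠ 2 := by
      intro h
      have := Nat.mod_eq_zero_of_dvd hdvd
      simp [Nat.mul_mod, Nat.add_mod, h] at this
    by_cases h1 : j = 1
    · exact Or.inl h1
    · exact Or.inr ⟨j / 3, by omega, by omega⟩
  · rw [mul_comm 2 j]
    rintro (rfl | ⟨n, hn, rfl | rfl⟩)
    -- The case `j = 1` is a single triple.
    · exact exists_competitionGraph_bose 0
    · exact exists_competitionGraph_skolem hn
    · exact exists_competitionGraph_bose n
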